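/- \textbf{Setting.} A submodular hypergraph $G=(V,E,\mathbf w,\boldsymbol\mu)$ has vertex set $V=\{1,\dots,N\}$, a set $E\subseteq 2^V$ of hyperedges, vertex weights $\mu_v>0$, and for each $e\in E$ a number $\vartheta_e\ge 0$ and a submodular function $w_e:2^e\to[0,1]$ with $w_e(\emptyset)=0$ and $w_e(S)=w_e(e\setminus S)$ for all $S\subseteq e$ (the usual normalization $\max_S w_e(S)=1$ is allowed but not needed). Put $\zeta(E)=\max_{e\in E}|e|$, $d_v=\sum_{e\ni v}\vartheta_e$, $\tau=\max_v d_v/\mu_v$, $\mathrm{vol}(S)=\sum_{v\in S}\mu_v$, $\mathrm{vol}(\partial S)=\sum_{e\in E}\vartheta_e w_e(S\cap e)$, $$c(S)=\frac{\mathrm{vol}(\partial S)}{\min\{\mathrm{vol}(S),\mathrm{vol}(V\setminus S)\}},\qquad h_2=\min_{S_1,S_2\neq\emptyset,\ S_1\cap S_2=\emptyset}\max\{c(S_1),c(S_2)\}.$$ For a nonconstant $x\in\mathbb R^N$ let $c(x)=\inf_{\theta\in[x_{\min},x_{\max})}c(\{v: x_v>\theta\})$. Let $\mathcal B_e=\{y\in\mathbb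 R^N: \sum_{v\in S}y_v\le w_e(S\cap e)\ \text{for all } S\subseteq V,\ \sum_{v\in V} y_v=0\}$, with set of extreme points $\mathcal E(\mathcal B_e)$. \textbf{Algorithm 1.} Fix $n\ge\zeta(E)$. (1) Find an optimal solution $X=(x'_1,\dots,x'_N)\in\mathbb R^{n\times N}$, $\eta\in\mathbb R^{E}$ of the SDP $$\min \sum_{e\in E}\vartheta_e\eta_e^2\quad\text{s.t.}\quad \|Xy\|_2^2\le\eta_e^2\ \ \forall e\in E,\ y\in\mathcal E(\mathcal B_e),\qquad \sum_v\mu_v\|x'_v\|_2^2=1,\qquad \sum_v\mu_v x'_v=0 .$$ (2) Draw a Gaussian vector $g\sim N(0,I_n)$. (3) Output $x=X^Tg$. \textbf{Theorem 6.} For every $\delta>0$ there is a constant $C>0$, depending only on $\delta$, such that for every submodular hypergraph $G$, every $n\ge\zeta(E)$ and every optimal solution $(X,\eta)$ of the SDP, the output $x=X^Tg$ of Algorithm 1 satisfies, with probability at least $1-\delta$, that $x$ is nonconstant and $$c(x)\le C\sqrt{\zeta(E)\,\tau\,h_2}.$$ -/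

import Mathlib

open MeasureTheory ProbabilityTheory
open scoped BigOperators

/-- A submodular hypergraph `G = (V, E, 𝐰, μ)` on a finite vertex set `V`: a set `E` of hyperedges
(subsets of `V`), positive vertex weights `μ`, and for every hyperedge `e` a nonnegative scale `ϑ e`
together with a symmetric submodular function `w e : 2^e → [0, 1]` with `w e ∅ = 0`. The cut of `e`
into `S` and `e \ S` weighs `ϑ e * w e S`. The usual scaling, in which the maximum of `w e` is `1`
(so that `ϑ e` is the maximal weight of a cut of `e`), is allowed but not required.
The values of `ϑ` and `w` at sets that are not hyperedges, and those of `w e` at sets that are not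
subsets of `e`, play no role. -/
structure SubmodularHypergraph (V : Type*) [DecidableEq V] where
  /-- the set of hyperedges -/
  E : Finset (Finset V)
  /-- the vertex weights -/
  μ : V → ℝ
  /-- the scale of each hyperedge -/
  ϑ : Finset V → ℝ
  /-- the (scaled) weights of the cuts of each hyperedge -/
  w : Finset V → Finset V → ℝ
  μ_pos : ∀ v, 0 < μ v
  ϑ_nonneg : ∀ e ∈ E, 0 ≤ ϑ e
  w_mem_Icc : ∀ e ∈ E, ∀ S, S ⊆ e → w e S ∈ Set.Icc (0 : ℝ) 1
  w_empty : ∀ e ∈ E, w e ∅ = 0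
  w_symm : ∀ e ∈ E, ∀ S, S ⊆ e → w e S = w e (e \ S)
  w_submod : ∀ e ∈ E, ∀ S T, S ⊆ e → T ⊆ e → w e (S ∪ T) + w e (S ∩ T) ≤ w e S + w e T

namespace SubmodularHypergraph

section

variable {V : Type*} [Fintype V] [DecidableEq V] (G : SubmodularHypergraph V)

/-- `ζ(E)`, the size of the largest hyperedge. -/
def maxEdgeCard : ℕ := G.E.sup Finset.card

/-- The degree `d_v = ∑_{e ∋ v} ϑ_e`. -/
def degree (v : V) : ℝ := ∑ e ∈ G.E with v ∈ e, G.ϑ e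

/-- `τ = max_v d_v / μ_v`. -/
noncomputable def tau : ℝ := ⨆ v, G.degree v / G.μ v

/-- `vol(S) = ∑_{v ∈ S} μ_v`. -/
def vol (S : Finset V) : ℝ := ∑ v ∈ S, G.μ v

/-- `vol(∂S) = ∑_{e ∈ E} ϑ_e w_e(S ∩ e)`. -/
def volBoundary (S : Finset V) : ℝ := ∑ e ∈ G.E, G.ϑ e * G.w e (S ∩ e)

/-- The conductance (normalized cut) `c(S) = vol(∂S) / min {vol(S), vol(V \ S)}`. -/
noncomputable def conductance (S : Finset V) : ℝ :=
  G.volBoundary S / min (G.vol S) (G.vol Sᶜ)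

/-- The `k`-way Cheeger constant `h_k`: the minimum of `max_i c(S_i)` over all families of `k`
nonempty pairwise disjoint sets of vertices. For `k = 2` it makes no difference whether the two sets
are also required to cover `V`, because `c(S) = c(V \ S)`. -/
noncomputable def cheegerConst (k : ℕ) : ℝ :=
  ⨅ S : {S : Fin k → Finset V // (∀ i, (S i).Nonempty) ∧ ∀ i j, i ≠ j → Disjoint (S i) (S j)},
    ⨆ i, G.conductance (S.1 i)

/-- The optimal conductance from thresholding a (nonconstant) vector `x`:
`c(x) = inf_{θ ∈ [x_min, x_max)} c({v : x_v > θ})`. -/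
noncomputable def thresholdConductance (x : V → ℝ) : ℝ :=
  sInf ((fun θ : ℝ => G.conductance {v | θ < x v}) '' Set.Ico (⨅ v, x v) (⨆ v, x v))

/-- The base polytope `𝓑_e` of the set function `S ↦ w_e(S ∩ e)` on `V`. -/
def basePolytope (e : Finset V) : Set (V → ℝ) :=
  {y | (∀ S : Finset V, ∑ v ∈ S, y v ≤ G.w e (S ∩ e)) ∧ ∑ v, y v = 0}

/-- Feasible points `(X, η)` of the SDP relaxation; `X v` is the column `x'_v ∈ ℝⁿ` of the vertex
`v`, so that `∑ v, y v • X v` is the vector `X y`. -/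
structure IsSDPFeasible {n : ℕ} (X : V → EuclideanSpace ℝ (Fin n)) (η : G.E → ℝ) : Prop where
  edge : ∀ e : G.E, ∀ y ∈ (G.basePolytope e).extremePoints ℝ, ‖∑ v, y v • X v‖ ^ 2 ≤ η e ^ 2
  norm : ∑ v, G.μ v * ‖X v‖ ^ 2 = 1
  mean : ∑ v, G.μ v • X v = 0

/-- The objective `∑_e ϑ_e η_e²` of the SDP relaxation. -/
def sdpObjective (η : G.E → ℝ) : ℝ := ∑ e : G.E, G.ϑ e * η e ^ 2

/-- `(X, η)` is an optimal solution of the SDP relaxation. -/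
structure IsSDPSolution {n : ℕ} (X : V → EuclideanSpace ℝ (Fin n)) (η : G.E → ℝ) : Prop where
  feasible : G.IsSDPFeasible X η
  le : ∀ (X' : V → EuclideanSpace ℝ (Fin n)) (η' : G.E → ℝ),
    G.IsSDPFeasible X' η' → G.sdpObjective η ≤ G.sdpObjective η'

end

end SubmodularHypergraph

/-- The rounding step of the algorithm: `x = Xᵀ g`, that is `x_v = ⟨x'_v, g⟩`. -/
noncomputable def gaussianRounding {V : Type*} {n : ℕ} (X : V → EuclideanSpace ℝ (Fin n))
    (g : EuclideanSpace ℝ (Fin n)) : V → ℝ :=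
  fun v => inner ℝ (X v) g

/-! The proof combines a Cheeger-type sweep bound with Gaussian rounding.

Sweep (`sq_thresholdConductance_mul_le`): sort the vertices by a mean-zero `x`. The greedy points
`y_e` of the base polytopes turn `∑ v, y_e v * x v` into the Lovász extension of `w_e`, a sum over
level sets. Applying this to `z * |z|`, where `z` is `x` shifted to a weighted median, and then
Cauchy–Schwarz, gives `c(x)² ∑ μ x² ≤ 4 τ ∑ ϑ_e ⟨y_e, x⟩²`.

Relaxation (`sdpObjective_le_cheegerConst`): normalized centred indicators are feasible, so the SDP
value is at most `2 h₂`.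

Rounding: for `x = Xᵀ g` one has `⟨y_e, x⟩ = ⟨X y_e, g⟩`. Although `y_e` depends on `g`, the vector
`X y_e` has norm at most `|η_e|` and lies in the fixed span of the columns of `e`. Its squared
product with `g` is thus at most `η_e²` times the squared norm of a projection of `g`, of mean at
most `|e| ≤ ζ`. Markov's inequality bounds the energy by a multiple of `ζ h₂`, and a small-ball
estimate keeps `∑ μ x²` away from zero; each fails with probability at most `δ / 2`. -/

/-! ### Summation by parts and the function `z * |z|` -/

/-- Summation by parts over `Fin (M + 1)`. -/
theorem Fin.sum_sub_mul_eq {M : ℕ} (a : ℕ → ℝ) (b : Fin (M + 1) → ℝ) (h0 : a 0 = 0)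
    (hM : a (M + 1) = 0) :
    ∑ i : Fin (M + 1), (a i - a (i + 1)) * b i =
      ∑ i : Fin M, a (i + 1) * (b i.succ - b i.castSucc) := by
  simp only [sub_mul, mul_sub, Finset.sum_sub_distrib]
  rw [Fin.sum_univ_succ (fun i : Fin (M + 1) => a i * b i),
    Fin.sum_univ_castSucc (fun i : Fin (M + 1) => a (i + 1) * b i)]
  simp [h0, hM]

theorem mul_abs_sub_mul_abs_nonneg {a b : ℝ} (hab : a ≤ b) : 0 ≤ b * |b| - a * |a| := by
  rcases le_total 0 a with ha | ha <;> rcases le_total 0 b with hb | hb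
  · rw [abs_of_nonneg ha, abs_of_nonneg hb]; nlinarith
  · rw [abs_of_nonneg ha, abs_of_nonpos hb]; nlinarith
  · rw [abs_of_nonpos ha, abs_of_nonneg hb]; nlinarith
  · rw [abs_of_nonpos ha, abs_of_nonpos hb]; nlinarith

/-- The function `z * |z|` has derivative `2 * |z|`, at most `2 * R` on `[-R, R]`. -/
theorem mul_abs_sub_mul_abs_le {a b R : ℝ} (hab : a ≤ b) (ha : |a| ≤ R) (hb : |b| ≤ R) :
    b * |b| - a * |a| ≤ 2 * R * (b - a) := by
  obtain ⟨ha1, ha2⟩ := abs_le.mp ha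
  obtain ⟨hb1, hb2⟩ := abs_le.mp hb
  rcases le_total 0 a with ha | ha <;> rcases le_total 0 b with hb | hb
  · rw [abs_of_nonneg ha, abs_of_nonneg hb]; nlinarith
  · rw [abs_of_nonneg ha, abs_of_nonpos hb]; nlinarith
  · rw [abs_of_nonpos ha, abs_of_nonneg hb]
    nlinarith [mul_nonneg hb (sub_nonneg.2 hb2), mul_nonneg (neg_nonneg.2 ha) (by linarith : 0 ≤ R + a)]
  · rw [abs_of_nonpos ha, abs_of_nonpos hb]; nlinarith

/-! ### Upper segments of an order -/

/-- The vertices of rank at least `i` in the order given by the permutation `σ`. -/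
def upperSegment {N : ℕ} (σ : Equiv.Perm (Fin N)) (i : ℕ) : Finset (Fin N) :=
  {v | i ≤ (σ.symm v : ℕ)}

section UpperSegment

variable {N : ℕ} (σ : Equiv.Perm (Fin N))

@[simp]
theorem mem_upperSegment {i : ℕ} {v : Fin N} : v ∈ upperSegment σ i ↔ i ≤ (σ.symm v : ℕ) := by
  simp [upperSegment]

theorem upperSegment_zero : upperSegment σ 0 = Finset.univ := by
  ext; simp

theorem upperSegment_self : upperSegment σ N = ∅ := by
  ext v; simp

theorem upperSegment_eq_insert (i : Fin N) :
    upperSegment σ i = insert (σ i) (upperSegment σ (i + 1)) := by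
  ext v
  simp only [mem_upperSegment, Finset.mem_insert, ← Equiv.symm_apply_eq, Fin.ext_iff]
  omega

theorem apply_notMem_upperSegment (i : Fin N) : σ i ∉ upperSegment σ (i + 1) := by
  simp

theorem upperSegment_antitone : Antitone (upperSegment σ) := by
  intro i j hij v
  simp only [mem_upperSegment]
  omega

theorem sum_sub_upperSegment (F : Finset (Fin N) → ℝ) :
    ∑ v, (F (upperSegment σ (σ.symm v)) - F (upperSegment σ ((σ.symm v : ℕ) + 1))) =
      F Finset.univ - F ∅ := by
  rw [← Equiv.sum_comp σ]
  simp only [Equiv.symm_apply_apply]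
  rw [Fin.sum_univ_eq_sum_range
    (fun i => F (upperSegment σ i) - F (upperSegment σ (i + 1))) N, Finset.sum_range_sub',
    upperSegment_zero, upperSegment_self]

end UpperSegment

/-! ### Cuts, volumes and degrees -/

namespace SubmodularHypergraph

section

variable {V : Type*} [DecidableEq V] (G : SubmodularHypergraph V)

theorem w_inter_submod {e : Finset V} (he : e ∈ G.E) (S T : Finset V) :
    G.w e ((S ∪ T) ∩ e) + G.w e ((S ∩ T) ∩ e) ≤ G.w e (S ∩ e) + G.w e (T ∩ e) := by
  have := G.w_submod e he (S ∩ e) (T ∩ e) Finset.inter_subset_right Finset.inter_subset_right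
  rwa [← Finset.union_inter_distrib_right, ← Finset.inter_inter_distrib_right] at this

theorem w_inter_nonneg {e : Finset V} (he : e ∈ G.E) (S : Finset V) : 0 ≤ G.w e (S ∩ e) :=
  (G.w_mem_Icc e he _ Finset.inter_subset_right).1

theorem w_inter_le_one {e : Finset V} (he : e ∈ G.E) (S : Finset V) : G.w e (S ∩ e) ≤ 1 :=
  (G.w_mem_Icc e he _ Finset.inter_subset_right).2

theorem w_self {e : Finset V} (he : e ∈ G.E) : G.w e e = 0 := by
  rw [G.w_symm e he e subset_rfl, Finset.sdiff_self]
  exact G.w_empty e he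

theorem vol_nonneg (S : Finset V) : 0 ≤ G.vol S :=
  Finset.sum_nonneg fun v _ => (G.μ_pos v).le

theorem vol_pos {S : Finset V} (hS : S.Nonempty) : 0 < G.vol S :=
  Finset.sum_pos (fun v _ => G.μ_pos v) hS

theorem vol_mono {S T : Finset V} (h : S ⊆ T) : G.vol S ≤ G.vol T :=
  Finset.sum_le_sum_of_subset_of_nonneg h fun v _ _ => (G.μ_pos v).le

theorem degree_nonneg (v : V) : 0 ≤ G.degree v :=
  Finset.sum_nonneg fun _ he => G.ϑ_nonneg _ (Finset.mem_filter.1 he).1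

theorem volBoundary_nonneg (S : Finset V) : 0 ≤ G.volBoundary S :=
  Finset.sum_nonneg fun e he => mul_nonneg (G.ϑ_nonneg e he) (G.w_inter_nonneg he S)

theorem tau_nonneg : 0 ≤ G.tau :=
  Real.iSup_nonneg fun v => div_nonneg (G.degree_nonneg v) (G.μ_pos v).le

end

section

variable {V : Type*} [Fintype V] [DecidableEq V] (G : SubmodularHypergraph V)

theorem w_compl_inter {e : Finset V} (he : e ∈ G.E) (S : Finset V) :
    G.w e (Sᶜ ∩ e) = G.w e (S ∩ e) := by
  rw [G.w_symm e he (S ∩ e) Finset.inter_subset_right]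
  congr 1
  ext v
  simp only [Finset.mem_inter, Finset.mem_compl, Finset.mem_sdiff]
  tauto

theorem vol_add_vol_compl (S : Finset V) : G.vol S + G.vol Sᶜ = G.vol Finset.univ :=
  Finset.sum_add_sum_compl S G.μ

theorem conductance_nonneg (S : Finset V) : 0 ≤ G.conductance S :=
  div_nonneg (G.volBoundary_nonneg S) (le_min (G.vol_nonneg _) (G.vol_nonneg _))

theorem thresholdConductance_nonneg (x : V → ℝ) : 0 ≤ G.thresholdConductance x := by
  refine Real.sInf_nonneg ?_
  rintro _ ⟨θ, -, rfl⟩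
  exact G.conductance_nonneg _

theorem thresholdConductance_le (x : V → ℝ) {u v : V} (huv : x u < x v) :
    G.thresholdConductance x ≤ G.conductance {w | x u < x w} := by
  refine csInf_le ⟨0, ?_⟩ ⟨x u, ⟨ciInf_le (Set.finite_range x).bddBelow u,
    huv.trans_le (le_ciSup (Set.finite_range x).bddAbove v)⟩, rfl⟩
  rintro _ ⟨θ, -, rfl⟩
  exact G.conductance_nonneg _

theorem degree_le_tau_mul (v : V) : G.degree v ≤ G.tau * G.μ v := by
  rw [← div_le_iff₀ (G.μ_pos v)]
  exact le_ciSup (f := fun v => G.degree v / G.μ v) (Set.finite_range _).bddAbove v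

theorem sum_edge_sum_sq_le (z : V → ℝ) :
    ∑ e ∈ G.E, G.ϑ e * ∑ v ∈ e, z v ^ 2 ≤ G.tau * ∑ v, G.μ v * z v ^ 2 := by
  have h : ∑ e ∈ G.E, G.ϑ e * ∑ v ∈ e, z v ^ 2 = ∑ v, G.degree v * z v ^ 2 := by
    simp only [degree, Finset.mul_sum, Finset.sum_mul, Finset.sum_filter]
    rw [Finset.sum_comm]
    refine Finset.sum_congr rfl fun e _ => ?_
    simp [ite_mul]
  rw [h, Finset.mul_sum]
  refine Finset.sum_le_sum fun v _ => ?_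
  rw [← mul_assoc]
  exact mul_le_mul_of_nonneg_right (G.degree_le_tau_mul v) (sq_nonneg _)

/-- The second moment is least about the mean; this pays for the shift to a median. -/
theorem sum_mul_sq_le_of_mean_zero {x : V → ℝ} (hx : ∑ v, G.μ v * x v = 0) (m : ℝ) :
    ∑ v, G.μ v * x v ^ 2 ≤ ∑ v, G.μ v * (x v - m) ^ 2 := by
  have h : ∑ v, G.μ v * (x v - m) ^ 2 =
      ∑ v, G.μ v * x v ^ 2 - 2 * m * ∑ v, G.μ v * x v + m ^ 2 * G.vol Finset.univ := by
    rw [vol, Finset.mul_sum, Finset.mul_sum, ← Finset.sum_sub_distrib, ← Finset.sum_add_distrib]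
    exact Finset.sum_congr rfl fun v _ => by ring
  rw [h, hx]
  nlinarith [mul_nonneg (sq_nonneg m) (G.vol_nonneg Finset.univ)]

end

/-! ### Greedy points of the base polytope -/

section

variable {N : ℕ} (G : SubmodularHypergraph (Fin N)) (σ : Equiv.Perm (Fin N))

/-- The point of the base polytope of `e` that the greedy algorithm finds for the order `σ`. -/
def greedyBase (e : Finset (Fin N)) (v : Fin N) : ℝ :=
  G.w e (upperSegment σ (σ.symm v) ∩ e) - G.w e (upperSegment σ ((σ.symm v : ℕ) + 1) ∩ e)

theorem greedyBase_mem_basePolytope {e : Finset (Fin N)} (he : e ∈ G.E) :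
    G.greedyBase σ e ∈ G.basePolytope e := by
  constructor
  · intro T
    -- Telescoping along the traces of the segments on `T`. Submodularity bounds each greedy
    -- marginal at `v ∈ T` by the marginal over the smaller set; for `v ∉ T` the trace does not
    -- change.
    have key : ∑ v, (G.w e ((T ∩ upperSegment σ (σ.symm v)) ∩ e) -
        G.w e ((T ∩ upperSegment σ ((σ.symm v : ℕ) + 1)) ∩ e)) = G.w e (T ∩ e) := by
      rw [sum_sub_upperSegment σ (fun S => G.w e ((T ∩ S) ∩ e))]
      simp [G.w_empty e he]
    rw [← key, ← Finset.sum_subset (Finset.subset_univ T)]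
    · refine Finset.sum_le_sum fun v hv => ?_
      have hs := G.w_inter_submod he (T ∩ upperSegment σ (σ.symm v))
        (upperSegment σ ((σ.symm v : ℕ) + 1))
      have hins := upperSegment_eq_insert σ (σ.symm v)
      rw [Equiv.apply_symm_apply] at hins
      have h1 : T ∩ upperSegment σ (σ.symm v) ∪ upperSegment σ ((σ.symm v : ℕ) + 1) =
          upperSegment σ (σ.symm v) := by
        rw [hins]; ext u; simp only [Finset.mem_union, Finset.mem_inter, Finset.mem_insert]
        constructor
        · tauto
        · rintro (rfl | h) <;> tauto
      have h2 : T ∩ upperSegment σ (σ.symm v) ∩ upperSegment σ ((σ.symm v : ℕ) + 1) =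
          T ∩ upperSegment σ ((σ.symm v : ℕ) + 1) := by
        rw [hins]; ext u; simp only [Finset.mem_inter, Finset.mem_insert]; tauto
      rw [h1, h2] at hs
      rw [greedyBase]
      linarith
    · intro v _ hv
      have hins := upperSegment_eq_insert σ (σ.symm v)
      rw [Equiv.apply_symm_apply] at hins
      rw [hins, Finset.inter_insert_of_notMem hv, sub_self]
  · have := sum_sub_upperSegment σ (fun S => G.w e (S ∩ e))
    simp only [greedyBase]
    rw [this]
    simp [G.w_empty e he, G.w_self he]

end

/-! ### The sweep-cut inequality -/

section

variable {M : ℕ} (G : SubmodularHypergraph (Fin (M + 1))) (σ : Equiv.Perm (Fin (M + 1)))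

/-- The boundary terms of the summation by parts vanish because `w e` is zero at `∅` and at `e`. -/
theorem sum_greedyBase_mul {e : Finset (Fin (M + 1))} (he : e ∈ G.E) (b : Fin (M + 1) → ℝ) :
    ∑ v, G.greedyBase σ e v * b v =
      ∑ i : Fin M, G.w e (upperSegment σ (i + 1) ∩ e) *
        (b (σ i.succ) - b (σ i.castSucc)) := by
  rw [← Equiv.sum_comp σ]
  simp only [greedyBase, Equiv.symm_apply_apply]
  refine Fin.sum_sub_mul_eq (fun i => G.w e (upperSegment σ i ∩ e)) (fun i => b (σ i)) ?_ ?_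
  · simp [upperSegment_zero, G.w_self he]
  · simp [upperSegment_self, G.w_empty e he]

theorem vol_upperSegment (i : Fin (M + 1)) :
    G.vol (upperSegment σ i) = G.μ (σ i) + G.vol (upperSegment σ (i + 1)) := by
  rw [vol, upperSegment_eq_insert, Finset.sum_insert (apply_notMem_upperSegment σ i), vol]

/-- Take the least `k` for which the segment above it has at most half the volume; monotonicity of
volume settles every other rank. -/
theorem exists_weighted_median : ∃ k : Fin (M + 1),
    (∀ i : ℕ, i ≤ k → G.vol (upperSegment σ i)ᶜ ≤ G.vol (upperSegment σ i)) ∧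
    ∀ i : ℕ, (k : ℕ) < i → G.vol (upperSegment σ i) ≤ G.vol (upperSegment σ i)ᶜ := by
  have hM : G.vol (upperSegment σ (M + 1)) ≤ G.vol (upperSegment σ (M + 1))ᶜ := by
    rw [upperSegment_self]; exact G.vol_mono (by simp)
  have hex : ∃ k, G.vol (upperSegment σ (k + 1)) ≤ G.vol (upperSegment σ (k + 1))ᶜ := ⟨M, hM⟩
  classical
  refine ⟨⟨Nat.find hex, Nat.lt_succ_of_le (Nat.find_min' hex hM)⟩, ?_, ?_⟩
  · intro i hi
    rcases i with - | j
    · rw [upperSegment_zero]; exact G.vol_mono (by simp)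
    · exact (not_le.1 (Nat.find_min hex (m := j) hi)).le
  · intro i hi
    have hsub := upperSegment_antitone σ (Nat.succ_le_of_lt hi)
    exact (G.vol_mono hsub).trans ((Nat.find_spec hex).trans
      (G.vol_mono (Finset.compl_subset_compl.2 hsub)))

/-- In the summation by parts, the smaller volume changes by `-μ` below the median and by `μ` above
it, matching the sign of `z`; at the median itself `z = 0`. -/
theorem sum_min_vol_mul_eq {k : Fin (M + 1)}
    (hk1 : ∀ i : ℕ, i ≤ k → G.vol (upperSegment σ i)ᶜ ≤ G.vol (upperSegment σ i))
    (hk2 : ∀ i : ℕ, (k : ℕ) < i → G.vol (upperSegment σ i) ≤ G.vol (upperSegment σ i)ᶜ)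
    {z : Fin (M + 1) → ℝ} (hz : Monotone (z ∘ σ)) (hzk : z (σ k) = 0) :
    ∑ i : Fin M, min (G.vol (upperSegment σ (i + 1))) (G.vol (upperSegment σ (i + 1))ᶜ) *
        (z (σ i.succ) * |z (σ i.succ)| - z (σ i.castSucc) * |z (σ i.castSucc)|) =
      ∑ v, G.μ v * z v ^ 2 := by
  rw [← Fin.sum_sub_mul_eq
    (fun i => min (G.vol (upperSegment σ i)) (G.vol (upperSegment σ i)ᶜ))
    (fun i => z (σ i) * |z (σ i)|), ← Equiv.sum_comp σ (fun v => G.μ v * z v ^ 2)]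
  · refine Finset.sum_congr rfl fun i _ => ?_
    have hv := G.vol_upperSegment σ i
    have hc1 := G.vol_add_vol_compl (upperSegment σ i)
    have hc2 := G.vol_add_vol_compl (upperSegment σ (i + 1))
    rcases lt_trichotomy i k with h | rfl | h
    · have hle : z (σ i) ≤ 0 := hzk ▸ hz h.le
      rw [min_eq_right (hk1 i (by exact_mod_cast h.le)), min_eq_right (hk1 (i + 1) h),
        abs_of_nonpos hle]
      have : G.vol (upperSegment σ i)ᶜ - G.vol (upperSegment σ (i + 1))ᶜ = -G.μ (σ i) := by
        linarith
      rw [this]; ring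
    · simp [hzk]
    · have hle : 0 ≤ z (σ i) := hzk ▸ hz h.le
      rw [min_eq_left (hk2 i h), min_eq_left (hk2 (i + 1) (Nat.lt_succ_of_lt h)),
        abs_of_nonneg hle, hv]
      ring
  · rw [upperSegment_zero]
    simpa [vol] using G.vol_nonneg Finset.univ
  · rw [upperSegment_self]
    simpa [vol] using G.vol_nonneg Finset.univ

theorem thresholdConductance_mul_min_vol_le {x : Fin (M + 1) → ℝ} (hx : Monotone (x ∘ σ))
    (i : Fin M) (h : x (σ i.castSucc) < x (σ i.succ)) :
    G.thresholdConductance x *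
        min (G.vol (upperSegment σ (i + 1))) (G.vol (upperSegment σ (i + 1))ᶜ) ≤
      G.volBoundary (upperSegment σ (i + 1)) := by
  have hset : ({w | x (σ i.castSucc) < x w} : Finset (Fin (M + 1))) = upperSegment σ (i + 1) := by
    ext w
    simp only [Finset.mem_filter, Finset.mem_univ, true_and, mem_upperSegment]
    constructor
    · intro hw
      by_contra hlt
      have : σ.symm w ≤ i.castSucc := by
        rw [Fin.le_def, Fin.val_castSucc]; omega
      have := hx this
      simp only [Function.comp, Equiv.apply_symm_apply] at this
      linarith
    · intro hw
      have : i.succ ≤ σ.symm w := by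
        rw [Fin.le_def, Fin.val_succ]; omega
      have := hx this
      simp only [Function.comp, Equiv.apply_symm_apply] at this
      linarith
  have hc := G.thresholdConductance_le x h
  rw [hset, conductance] at hc
  have hpos : 0 < min (G.vol (upperSegment σ (i + 1))) (G.vol (upperSegment σ (i + 1))ᶜ) := by
    refine lt_min (G.vol_pos ⟨σ i.succ, by simp⟩) (G.vol_pos ⟨σ i.castSucc, by simp⟩)
  exact (le_div_iff₀ hpos).1 hc

/-- Only segments that split `e` contribute. Then `e` has vertices on both sides of the gap, so both
end values lie between values of `z` on `e`. -/
theorem sum_greedyBase_mul_mul_abs_le {e : Finset (Fin (M + 1))} (he : e ∈ G.E)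
    {z : Fin (M + 1) → ℝ} (hz : Monotone (z ∘ σ)) :
    ∑ v, G.greedyBase σ e v * (z v * |z v|) ≤
      2 * √(∑ v ∈ e, z v ^ 2) * ∑ v, G.greedyBase σ e v * z v := by
  rw [G.sum_greedyBase_mul σ he, G.sum_greedyBase_mul σ he, Finset.mul_sum]
  refine Finset.sum_le_sum fun i _ => ?_
  have hle : z (σ i.castSucc) ≤ z (σ i.succ) := hz i.castSucc_lt_succ.le
  have hR : ∀ v ∈ e, |z v| ≤ √(∑ v ∈ e, z v ^ 2) := fun v hv =>
    Real.abs_le_sqrt (Finset.single_le_sum (f := fun v => z v ^ 2) (fun _ _ => sq_nonneg _) hv)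
  rw [mul_left_comm]
  by_cases h1 : upperSegment σ (i + 1) ∩ e = ∅
  · simp [h1, G.w_empty e he]
  by_cases h2 : upperSegment σ (i + 1) ∩ e = e
  · simp [h2, G.w_self he]
  refine mul_le_mul_of_nonneg_left ?_ (G.w_inter_nonneg he _)
  obtain ⟨v, hv⟩ := Finset.nonempty_iff_ne_empty.2 h1
  rw [Finset.mem_inter, mem_upperSegment] at hv
  rw [Finset.inter_eq_right, Finset.not_subset] at h2
  obtain ⟨u, hue, hu⟩ := h2
  rw [mem_upperSegment] at hu
  have hv' : z (σ i.succ) ≤ z v := by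
    have : i.succ ≤ σ.symm v := by rw [Fin.le_def, Fin.val_succ]; omega
    simpa using hz this
  have hu' : z u ≤ z (σ i.castSucc) := by
    have : σ.symm u ≤ i.castSucc := by rw [Fin.le_def, Fin.val_castSucc]; omega
    simpa using hz this
  have hvR := abs_le.1 (hR v hv.2)
  have huR := abs_le.1 (hR u hue)
  exact mul_abs_sub_mul_abs_le hle (abs_le.2 ⟨by linarith, by linarith⟩)
    (abs_le.2 ⟨by linarith, by linarith⟩)

end

/-- The sweep-cut inequality: thresholding a mean-zero vector `x` finds a set of conductance at
most `2 √(τ Q(x) / ‖x‖²)`, where `Q` is the energy given by the Lovász extensions. -/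
theorem sq_thresholdConductance_mul_le {N : ℕ} (G : SubmodularHypergraph (Fin N))
    {x : Fin N → ℝ} (hx : ∑ v, G.μ v * x v = 0) :
    ∃ y : Finset (Fin N) → Fin N → ℝ, (∀ e ∈ G.E, y e ∈ G.basePolytope e) ∧
      G.thresholdConductance x ^ 2 * ∑ v, G.μ v * x v ^ 2 ≤
        4 * G.tau * ∑ e ∈ G.E, G.ϑ e * (∑ v, y e v * x v) ^ 2 := by
  rcases N with - | M
  · refine ⟨G.greedyBase 1, fun e he => G.greedyBase_mem_basePolytope 1 he, ?_⟩
    simp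
  set σ := Tuple.sort x with hσ
  have hmono : Monotone (x ∘ σ) := Tuple.monotone_sort x
  refine ⟨G.greedyBase σ, fun e he => G.greedyBase_mem_basePolytope σ he, ?_⟩
  obtain ⟨k, hk1, hk2⟩ := G.exists_weighted_median σ
  set z : Fin (M + 1) → ℝ := fun v => x v - x (σ k) with hz
  have hzmono : Monotone (z ∘ σ) := fun i j hij => sub_le_sub_right (hmono hij) _
  have hA := G.sum_min_vol_mul_eq σ hk1 hk2 hzmono (by simp [hz])
  set A := ∑ v, G.μ v * z v ^ 2 with hAdef
  have hA0 : 0 ≤ A := Finset.sum_nonneg fun v _ => mul_nonneg (G.μ_pos v).le (sq_nonneg _)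
  set c := G.thresholdConductance x
  have hc0 : 0 ≤ c := G.thresholdConductance_nonneg x
  set L : Finset (Fin (M + 1)) → ℝ := fun e => ∑ v, G.greedyBase σ e v * x v with hL
  have hLz : ∀ e ∈ G.E, ∑ v, G.greedyBase σ e v * z v = L e := fun e he => by
    -- Points of the base polytope have coordinate sum zero, so the shift is invisible.
    simp only [hz, mul_sub, Finset.sum_sub_distrib, ← Finset.sum_mul,
      (G.greedyBase_mem_basePolytope σ he).2, hL]
    ring
  set Q := ∑ e ∈ G.E, G.ϑ e * L e ^ 2 with hQ
  have hQ0 : 0 ≤ Q := Finset.sum_nonneg fun e he => mul_nonneg (G.ϑ_nonneg e he) (sq_nonneg _)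
  set R : Finset (Fin (M + 1)) → ℝ := fun e => √(∑ v ∈ e, z v ^ 2) with hR
  have hRsq : ∀ e, R e ^ 2 = ∑ v ∈ e, z v ^ 2 := fun e =>
    Real.sq_sqrt (Finset.sum_nonneg fun _ _ => sq_nonneg _)
  have h1 : c * A ≤ ∑ e ∈ G.E, G.ϑ e * ∑ v, G.greedyBase σ e v * (z v * |z v|) := by
    calc c * A ≤ ∑ i : Fin M, G.volBoundary (upperSegment σ (i + 1)) *
          (z (σ i.succ) * |z (σ i.succ)| - z (σ i.castSucc) * |z (σ i.castSucc)|) := by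
          rw [← hA, Finset.mul_sum]
          refine Finset.sum_le_sum fun i _ => ?_
          have hle : x (σ i.castSucc) ≤ x (σ i.succ) := hmono i.castSucc_lt_succ.le
          -- At a tie the segment need not be a threshold set, but the increment is zero.
          rcases hle.eq_or_lt with h | h
          · simp [hz, h]
          · rw [← mul_assoc]
            exact mul_le_mul_of_nonneg_right (G.thresholdConductance_mul_min_vol_le σ hmono i h)
              (mul_abs_sub_mul_abs_nonneg (sub_le_sub_right hle _))
      _ = _ := by
          simp only [volBoundary, Finset.sum_mul]
          rw [Finset.sum_comm]
          refine Finset.sum_congr rfl fun e he => ?_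
          rw [G.sum_greedyBase_mul σ he (fun v => z v * |z v|), Finset.mul_sum]
          exact Finset.sum_congr rfl fun i _ => mul_assoc _ _ _
  have h2 : c * A ≤ 2 * ∑ e ∈ G.E, G.ϑ e * (R e * L e) := by
    refine h1.trans ?_
    rw [Finset.mul_sum]
    refine Finset.sum_le_sum fun e he => ?_
    have := mul_le_mul_of_nonneg_left (G.sum_greedyBase_mul_mul_abs_le σ he hzmono)
      (G.ϑ_nonneg e he)
    rw [hLz e he] at this
    refine this.trans (le_of_eq ?_)
    simp only [hR]; ring
  have h3 : (∑ e ∈ G.E, G.ϑ e * (R e * L e)) ^ 2 ≤ (∑ e ∈ G.E, G.ϑ e * R e ^ 2) * Q := by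
    refine Finset.sum_sq_le_sum_mul_sum_of_sq_le_mul _
      (fun e he => mul_nonneg (G.ϑ_nonneg e he) (sq_nonneg _))
      (fun e he => mul_nonneg (G.ϑ_nonneg e he) (sq_nonneg _)) fun e _ => le_of_eq (by ring)
  have h4 : ∑ e ∈ G.E, G.ϑ e * R e ^ 2 ≤ G.tau * A := by
    simp only [hRsq]; exact G.sum_edge_sum_sq_le z
  have h5 : (c * A) ^ 2 ≤ 4 * (G.tau * A * Q) := by
    have := pow_le_pow_left₀ (mul_nonneg hc0 hA0) h2 2
    nlinarith [mul_le_mul_of_nonneg_right h4 hQ0]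
  have h6 : c ^ 2 * A ≤ 4 * G.tau * Q := by
    rcases hA0.eq_or_lt with h | h
    · rw [← h, mul_zero]
      exact mul_nonneg (mul_nonneg (by norm_num) G.tau_nonneg) hQ0
    · refine le_of_mul_le_mul_right ?_ h
      linarith [h5]
  exact (mul_le_mul_of_nonneg_left (G.sum_mul_sq_le_of_mean_zero hx _) (sq_nonneg c)).trans h6

end SubmodularHypergraph

/-! ### The base polytope and the value of the SDP -/

namespace SubmodularHypergraph

variable {V : Type*} [Fintype V] [DecidableEq V] (G : SubmodularHypergraph V)

theorem neg_sum_le_of_mem_basePolytope {e : Finset V} (he : e ∈ G.E) {y : V → ℝ}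
    (hy : y ∈ G.basePolytope e) (S : Finset V) : -∑ v ∈ S, y v ≤ G.w e (S ∩ e) := by
  rw [← G.w_compl_inter he S]
  have h := hy.1 Sᶜ
  have := Finset.sum_add_sum_compl S y
  rw [hy.2] at this
  linarith

theorem abs_sum_le_of_mem_basePolytope {e : Finset V} (he : e ∈ G.E) {y : V → ℝ}
    (hy : y ∈ G.basePolytope e) (S : Finset V) : |∑ v ∈ S, y v| ≤ G.w e (S ∩ e) :=
  abs_le'.2 ⟨hy.1 S, G.neg_sum_le_of_mem_basePolytope he hy S⟩

theorem eq_zero_of_mem_basePolytope {e : Finset V} (he : e ∈ G.E) {y : V → ℝ}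
    (hy : y ∈ G.basePolytope e) {v : V} (hv : v ∉ e) : y v = 0 := by
  have h := G.abs_sum_le_of_mem_basePolytope he hy {v}
  rw [Finset.singleton_inter_of_notMem hv, G.w_empty e he, Finset.sum_singleton] at h
  exact abs_nonpos_iff.1 h

theorem isCompact_basePolytope {e : Finset V} (he : e ∈ G.E) : IsCompact (G.basePolytope e) := by
  refine (isCompact_Icc (a := fun _ : V => (-1 : ℝ)) (b := fun _ => 1)).of_isClosed_subset ?_ ?_
  · refine IsClosed.inter (s₁ := {y : V → ℝ | ∀ S : Finset V, ∑ v ∈ S, y v ≤ G.w e (S ∩ e)})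
      (s₂ := {y : V → ℝ | ∑ v, y v = 0}) ?_ ?_
    · simp only [Set.ofPred_forall]
      exact isClosed_iInter fun S => isClosed_le (by fun_prop) continuous_const
    · exact isClosed_eq (by fun_prop) continuous_const
  · intro y hy
    have h : ∀ v, |y v| ≤ 1 := fun v => by
      have := (G.abs_sum_le_of_mem_basePolytope he hy {v}).trans (G.w_inter_le_one he {v})
      rwa [Finset.sum_singleton] at this
    exact ⟨fun v => (abs_le.1 (h v)).1, fun v => (abs_le.1 (h v)).2⟩

theorem convex_basePolytope (e : Finset V) : Convex ℝ (G.basePolytope e) := by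
  intro y hy z hz a b ha hb hab
  refine ⟨fun S => ?_, ?_⟩
  · simp only [Pi.add_apply, Pi.smul_apply, smul_eq_mul, Finset.sum_add_distrib, ← Finset.mul_sum]
    calc _ ≤ a * G.w e (S ∩ e) + b * G.w e (S ∩ e) :=
          add_le_add (mul_le_mul_of_nonneg_left (hy.1 S) ha)
            (mul_le_mul_of_nonneg_left (hz.1 S) hb)
      _ = _ := by rw [← add_mul, hab, one_mul]
  · simp only [Pi.add_apply, Pi.smul_apply, smul_eq_mul, Finset.sum_add_distrib, ← Finset.mul_sum,
      hy.2, hz.2]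
    simp

variable {G}

/-- The edge constraints of the SDP extend from the extreme points to the whole base polytope. -/
theorem IsSDPFeasible.norm_sq_le {n : ℕ} {X : V → EuclideanSpace ℝ (Fin n)} {η : G.E → ℝ}
    (h : G.IsSDPFeasible X η) (e : G.E) {y : V → ℝ} (hy : y ∈ G.basePolytope e) :
    ‖∑ v, y v • X v‖ ^ 2 ≤ η e ^ 2 := by
  let f : (V → ℝ) →ₗ[ℝ] EuclideanSpace ℝ (Fin n) := Fintype.linearCombination ℝ X
  have hf : ∀ y, f y = ∑ v, y v • X v := fun y => Fintype.linearCombination_apply ℝ X y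
  have hcont : Continuous f := f.continuous_of_finiteDimensional
  -- Krein–Milman: the preimage of a ball is closed and convex, so containing the extreme points is
  -- enough.
  have hsub : closure (convexHull ℝ ((G.basePolytope e).extremePoints ℝ)) ⊆
      f ⁻¹' Metric.closedBall 0 |η e| := by
    refine closure_minimal (convexHull_min ?_ ?_) (Metric.isClosed_closedBall.preimage hcont)
    · intro z hz
      have := sq_le_sq.1 (h.edge e z hz)
      rw [abs_of_nonneg (norm_nonneg _)] at this
      simpa [hf] using this
    · exact (convex_closedBall _ _).linear_preimage f
  rw [closure_convexHull_extremePoints (G.isCompact_basePolytope e.2)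
    (G.convex_basePolytope e)] at hsub
  have := hsub hy
  rw [Set.mem_preimage, mem_closedBall_zero_iff, hf] at this
  rw [sq_le_sq, abs_of_nonneg (norm_nonneg _)]
  exact this

variable (G)

theorem sum_mul_indicator_sub (S : Finset V) (p : ℝ) :
    ∑ v, G.μ v * ((if v ∈ S then 1 else 0) - p) = G.vol S - p * G.vol Finset.univ := by
  simp only [mul_sub, Finset.sum_sub_distrib, mul_ite, mul_one, mul_zero, vol, Finset.mul_sum]
  simp [mul_comm]

theorem sum_mul_indicator_sub_sq (S : Finset V) (p : ℝ) :
    ∑ v, G.μ v * ((if v ∈ S then 1 else 0) - p) ^ 2 =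
      (1 - 2 * p) * G.vol S + p ^ 2 * G.vol Finset.univ := by
  have h : ∀ v, G.μ v * ((if v ∈ S then 1 else 0) - p) ^ 2 =
      (1 - 2 * p) * (if v ∈ S then G.μ v else 0) + p ^ 2 * G.μ v := fun v => by
    split_ifs <;> ring
  simp only [h, Finset.sum_add_distrib, ← Finset.mul_sum, vol]
  simp

variable {G}

/-- A centred indicator vector shows that the SDP is a relaxation of the sparsest cut problem. -/
theorem IsSDPSolution.sdpObjective_le_conductance {n : ℕ} {X : V → EuclideanSpace ℝ (Fin n)}
    {η : G.E → ℝ} (h : G.IsSDPSolution X η) (hn : 0 < n) {S : Finset V} (hS : S.Nonempty)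
    (hSc : Sᶜ.Nonempty) : G.sdpObjective η ≤ 2 * G.conductance S := by
  have ha := G.vol_pos hS
  have hb := G.vol_pos hSc
  have hab := G.vol_add_vol_compl S
  set a := G.vol S
  set b := G.vol Sᶜ
  -- `s` is the `μ`-weighted sum of squares of the indicator of `S` centred at its mean `p`.
  set s := a * b / (a + b) with hs
  have hs0 : 0 < s := by positivity
  set p := a / (a + b) with hp
  set r := (√s)⁻¹ with hr
  have hr2 : r ^ 2 = s⁻¹ := by rw [hr, inv_pow, Real.sq_sqrt hs0.le]
  set u : V → ℝ := fun v => (if v ∈ S then 1 else 0) - p with hu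
  set X' : V → EuclideanSpace ℝ (Fin n) :=
    fun v => (r * u v) • EuclideanSpace.single (⟨0, hn⟩ : Fin n) (1 : ℝ) with hX'
  have hnorm1 : ‖EuclideanSpace.single (⟨0, hn⟩ : Fin n) (1 : ℝ)‖ = 1 := by simp
  have hfeas : G.IsSDPFeasible X' (fun e => r * G.w e (S ∩ e)) := by
    refine ⟨fun e y hy => ?_, ?_, ?_⟩
    · have hy' := extremePoints_subset hy
      have hsum : ∑ v, y v • X' v =
          (r * ∑ v ∈ S, y v) • EuclideanSpace.single (⟨0, hn⟩ : Fin n) (1 : ℝ) := by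
        simp only [hX', smul_smul, ← Finset.sum_smul]
        congr 1
        have : ∀ v, y v * (r * u v) = r * ((if v ∈ S then y v else 0) - p * y v) := fun v => by
          simp only [hu]; split_ifs <;> ring
        simp only [this, ← Finset.mul_sum, Finset.sum_sub_distrib, hy'.2]
        simp
      rw [hsum, norm_smul, hnorm1, mul_one, Real.norm_eq_abs, sq_abs, mul_pow, mul_pow]
      refine mul_le_mul_of_nonneg_left ?_ (sq_nonneg r)
      exact sq_le_sq.2 ((G.abs_sum_le_of_mem_basePolytope e.2 hy' S).trans (le_abs_self _))
    · have h1 : ∀ v, G.μ v * ‖X' v‖ ^ 2 = s⁻¹ * (G.μ v * u v ^ 2) := fun v => by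
        rw [hX', norm_smul, hnorm1, mul_one, Real.norm_eq_abs, sq_abs, mul_pow, hr2]; ring
      simp only [h1, ← Finset.mul_sum, hu]
      rw [G.sum_mul_indicator_sub_sq, ← hab]
      change s⁻¹ * ((1 - 2 * p) * a + p ^ 2 * (a + b)) = 1
      rw [hs, hp]; field_simp; ring
    · simp only [hX', smul_smul, ← Finset.sum_smul]
      have h1 : ∀ v, G.μ v * (r * u v) = r * (G.μ v * u v) := fun v => by ring
      simp only [h1]
      rw [← Finset.mul_sum, hu, G.sum_mul_indicator_sub, ← hab]
      have : a - p * (a + b) = 0 := by rw [hp]; field_simp; ring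
      change (r * (a - p * (a + b))) • _ = _
      rw [this]; simp
  refine (h.le X' _ hfeas).trans ?_
  have h1 : G.sdpObjective (fun e => r * G.w e (S ∩ e)) ≤ s⁻¹ * G.volBoundary S := by
    rw [sdpObjective, volBoundary, Finset.mul_sum, ← Finset.sum_coe_sort G.E]
    refine Finset.sum_le_sum fun e _ => ?_
    rw [mul_pow, hr2]
    have hw0 := G.w_inter_nonneg e.2 S
    have hw1 := G.w_inter_le_one e.2 S
    -- The bound `w ≤ 1` turns the quadratic objective into the linear cut weight.
    have : G.w e (S ∩ e) ^ 2 ≤ G.w e (S ∩ e) := by nlinarith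
    calc _ = s⁻¹ * (G.ϑ e * G.w e (S ∩ e) ^ 2) := by ring
      _ ≤ _ := by
        gcongr
        exact G.ϑ_nonneg e e.2
  refine h1.trans ?_
  rw [conductance, inv_mul_eq_div, ← mul_div_assoc, mul_comm 2, mul_div_assoc, div_eq_mul_inv]
  refine mul_le_mul_of_nonneg_left ?_ (G.volBoundary_nonneg S)
  change s⁻¹ ≤ 2 / min a b
  have hm : 0 < min a b := lt_min ha hb
  rw [inv_le_comm₀ hs0 (by positivity), inv_div, hs, div_le_div_iff₀ (by norm_num) (by positivity)]
  have := min_mul_max a b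
  -- The factor `2` comes from `a * b / (a + b) ≥ min a b / 2`.
  have h2 : a + b ≤ 2 * max a b := by linarith [le_max_left a b, le_max_right a b]
  nlinarith

theorem IsSDPFeasible.exists_ne {n : ℕ} {X : V → EuclideanSpace ℝ (Fin n)}
    {η : G.E → ℝ} (h : G.IsSDPFeasible X η) : ∃ u v : V, u ≠ v := by
  by_contra! hcon
  have h1 : ∀ v, X v = 0 := fun v => by
    have hm := h.mean
    rw [Finset.sum_eq_single v (fun u _ huv => absurd (hcon u v) huv) (by simp)] at hm
    exact (smul_eq_zero.1 hm).resolve_left (G.μ_pos v).ne'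
  have := h.norm
  simp [h1] at this

theorem IsSDPFeasible.dim_pos {n : ℕ} {X : V → EuclideanSpace ℝ (Fin n)}
    {η : G.E → ℝ} (h : G.IsSDPFeasible X η) : 0 < n := by
  rcases Nat.eq_zero_or_pos n with rfl | hn
  · have := h.norm
    simp [Subsingleton.elim (X _) 0] at this
  · exact hn

/-- The value of the SDP is at most `2 h₂`. -/
theorem IsSDPSolution.sdpObjective_le_cheegerConst {n : ℕ} {X : V → EuclideanSpace ℝ (Fin n)}
    {η : G.E → ℝ} (h : G.IsSDPSolution X η) : G.sdpObjective η ≤ 2 * G.cheegerConst 2 := by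
  obtain ⟨u, v, huv⟩ := h.feasible.exists_ne
  -- A real infimum over an empty family would be the default `0`.
  have hne : Nonempty {S : Fin 2 → Finset V //
      (∀ i, (S i).Nonempty) ∧ ∀ i j, i ≠ j → Disjoint (S i) (S j)} := by
    refine ⟨⟨![{u}, {v}], ?_, ?_⟩⟩
    · intro i; fin_cases i <;> simp
    · intro i j hij; fin_cases i <;> fin_cases j <;> simp_all [huv.symm]
  rw [← div_le_iff₀' two_pos, cheegerConst]
  refine le_ciInf fun S => ?_
  have hc : ((S.1 0)ᶜ).Nonempty :=
    (S.2.1 1).mono (Finset.subset_compl_iff_disjoint_right.2 (S.2.2 1 0 (by decide)))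
  rw [div_le_iff₀' two_pos]
  refine (h.sdpObjective_le_conductance h.feasible.dim_pos (S.2.1 0) hc).trans ?_
  exact mul_le_mul_of_nonneg_left
    (le_ciSup (f := fun i => G.conductance (S.1 i)) (Set.finite_range _).bddAbove 0) two_pos.le

end SubmodularHypergraph

/-! ### Gaussian estimates -/

section StdGaussian

variable {E : Type*} [NormedAddCommGroup E] [InnerProductSpace ℝ E] [FiniteDimensional ℝ E]

/-- The squared norm of the orthogonal projection of `g` to `W`. -/
noncomputable def projNormSq (W : Submodule ℝ E) (g : E) : ℝ :=
  ∑ i, inner ℝ (stdOrthonormalBasis ℝ W i : E) g ^ 2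

theorem projNormSq_nonneg (W : Submodule ℝ E) (g : E) : 0 ≤ projNormSq W g :=
  Finset.sum_nonneg fun _ _ => sq_nonneg _

/-- Cauchy–Schwarz in an orthonormal basis of `W`. The bound is uniform in `u`, which may therefore
depend on `g`. -/
theorem inner_sq_le_norm_sq_mul_projNormSq {W : Submodule ℝ E} {u : E} (hu : u ∈ W) (g : E) :
    inner ℝ u g ^ 2 ≤ ‖u‖ ^ 2 * projNormSq W g := by
  set b := stdOrthonormalBasis ℝ W
  have h1 : u = ∑ i, inner ℝ (b i) (⟨u, hu⟩ : W) • (b i : E) := by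
    have := congrArg (W.subtype) (b.sum_repr' ⟨u, hu⟩)
    simpa using this.symm
  have h2 : ‖u‖ ^ 2 = ∑ i, inner ℝ (b i) (⟨u, hu⟩ : W) ^ 2 :=
    (b.sum_sq_inner_right ⟨u, hu⟩).symm
  have h3 : inner ℝ u g = ∑ i, inner ℝ (b i) (⟨u, hu⟩ : W) * inner ℝ (b i : E) g := by
    conv_lhs => rw [h1]
    simp [sum_inner, real_inner_smul_left]
  rw [h2, h3]
  exact Finset.sum_mul_sq_le_sq_mul_sq _ _ _

variable [MeasurableSpace E] [BorelSpace E]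

theorem memLp_two_inner_stdGaussian (u : E) :
    MemLp (fun g : E => inner ℝ u g) 2 (stdGaussian E) :=
  IsGaussian.memLp_dual (stdGaussian E) (innerSL ℝ u) 2 (by simp)

theorem integrable_inner_sq_stdGaussian (u : E) :
    Integrable (fun g : E => inner ℝ u g ^ 2) (stdGaussian E) :=
  (memLp_two_inner_stdGaussian u).integrable_sq

theorem integral_inner_sq_stdGaussian (u : E) :
    ∫ g : E, inner ℝ u g ^ 2 ∂stdGaussian E = ‖u‖ ^ 2 := by
  have h := variance_dual_stdGaussian (E := E) (innerSL ℝ u)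
  rw [variance_of_integral_eq_zero (by fun_prop) (integral_strongDual_stdGaussian _)] at h
  simpa using h

theorem stdGaussian_inner_sq_le {u : E} (hu : ‖u‖ = 1) (s : ℝ) :
    stdGaussian E {g | inner ℝ u g ^ 2 ≤ s} = gaussianReal 0 1 {z | z ^ 2 ≤ s} := by
  have hmap := IsGaussian.map_eq_gaussianReal (μ := stdGaussian E) (innerSL ℝ u)
  rw [integral_strongDual_stdGaussian, variance_dual_stdGaussian, innerSL_apply_norm, hu] at hmap
  simp only [one_pow, Real.toNNReal_one] at hmap
  rw [← hmap, Measure.map_apply (by fun_prop) (measurableSet_le (by fun_prop) (by fun_prop))]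
  rfl

theorem integrable_projNormSq (W : Submodule ℝ E) :
    Integrable (projNormSq W) (stdGaussian E) :=
  integrable_finsetSum _ fun _ _ => integrable_inner_sq_stdGaussian _

theorem integral_projNormSq (W : Submodule ℝ E) :
    ∫ g, projNormSq W g ∂stdGaussian E = Module.finrank ℝ W := by
  simp only [projNormSq]
  rw [integral_finsetSum _ fun _ _ => integrable_inner_sq_stdGaussian _]
  simp only [integral_inner_sq_stdGaussian]
  simp [-Submodule.coe_norm, ← Submodule.coe_norm]

/-- A weighted sum of squares of normalized Gaussians is unlikely to be small. -/
theorem stdGaussian_sum_inner_sq_le {ι : Type*} [Fintype ι] {c : ι → ℝ} (hc : ∀ i, 0 ≤ c i)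
    {X : ι → E} (hX : ∑ i, c i * ‖X i‖ ^ 2 = 1) {t : ℝ} (ht : 0 < t) :
    stdGaussian E {g | ∑ i, c i * inner ℝ (X i) g ^ 2 ≤ t} ≤
      2 * gaussianReal 0 1 {z | z ^ 2 ≤ 2 * t} := by
  -- `A i` is the event that term `i` is at most `2 * t` times its mean weight, and `f` is the total
  -- weight of such terms. A sum at most `t` forces `f ≥ 1/2`; Markov's inequality then needs no
  -- independence.
  set A : ι → Set E := fun i => {g | inner ℝ (X i) g ^ 2 ≤ 2 * t * ‖X i‖ ^ 2} with hA
  have hAm : ∀ i, MeasurableSet (A i) := fun i =>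
    measurableSet_le (by fun_prop) (by fun_prop)
  set q : ENNReal := gaussianReal 0 1 {z | z ^ 2 ≤ 2 * t}
  set f : E → ENNReal :=
    fun g => ∑ i, ENNReal.ofReal (c i * ‖X i‖ ^ 2) * (A i).indicator 1 g with hf
  have hp : ∀ i, 0 ≤ c i * ‖X i‖ ^ 2 := fun i => mul_nonneg (hc i) (sq_nonneg _)
  have hfm : Measurable f := Finset.measurable_sum _ fun i _ =>
    ((measurable_one.indicator (hAm i)).const_mul _)
  have hint : ∫⁻ g, f g ∂stdGaussian E ≤ q := by
    simp only [hf]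
    rw [lintegral_finsetSum _ fun i _ => (measurable_one.indicator (hAm i)).const_mul _]
    calc _ ≤ ∑ i, ENNReal.ofReal (c i * ‖X i‖ ^ 2) * q := by
          refine Finset.sum_le_sum fun i _ => ?_
          rw [lintegral_const_mul _ (measurable_one.indicator (hAm i)),
            lintegral_indicator_one (hAm i)]
          rcases eq_or_ne (X i) 0 with h0 | h0
          · simp [h0]
          · refine mul_le_mul_right (le_of_eq ?_) _
            have hn : 0 < ‖X i‖ := norm_pos_iff.2 h0
            change _ = gaussianReal 0 1 {z | z ^ 2 ≤ 2 * t}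
            rw [← stdGaussian_inner_sq_le (E := E) (u := ‖X i‖⁻¹ • X i)
              (norm_smul_inv_norm h0) (2 * t)]
            congr 1
            ext g
            simp only [hA, Set.mem_ofPred_eq, real_inner_smul_left, mul_pow, inv_pow]
            rw [inv_mul_le_iff₀ (by positivity), mul_comm]
      _ = q := by
          rw [← Finset.sum_mul, ← ENNReal.ofReal_sum_of_nonneg fun i _ => hp i, hX]
          simp
  have hsub : {g | ∑ i, c i * inner ℝ (X i) g ^ 2 ≤ t} ⊆ {g | 2⁻¹ ≤ f g} := by
    intro g hg
    simp only [Set.mem_ofPred_eq] at hg ⊢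
    have hfg : f g = ENNReal.ofReal (∑ i, c i * ‖X i‖ ^ 2 * (A i).indicator 1 g) := by
      rw [ENNReal.ofReal_sum_of_nonneg]
      · refine Finset.sum_congr rfl fun i _ => ?_
        by_cases h : g ∈ A i <;> simp [h]
      · exact fun i _ => mul_nonneg (hp i) (Set.indicator_nonneg (fun _ _ => zero_le_one) _)
    have h1 : ∀ i, 2 * t * (c i * ‖X i‖ ^ 2 - c i * ‖X i‖ ^ 2 * (A i).indicator 1 g) ≤
        c i * inner ℝ (X i) g ^ 2 := fun i => by
      by_cases h : g ∈ A i
      · simpa [h] using mul_nonneg (hc i) (sq_nonneg _)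
      · have h' : 2 * t * ‖X i‖ ^ 2 ≤ inner ℝ (X i) g ^ 2 := (not_le.1 h).le
        simp only [h, not_false_eq_true, Set.indicator_of_notMem, mul_zero, sub_zero]
        linarith [mul_le_mul_of_nonneg_left h' (hc i)]
    have h2 := (Finset.sum_le_sum fun i (_ : i ∈ Finset.univ) => h1 i).trans hg
    rw [← Finset.mul_sum, Finset.sum_sub_distrib, hX] at h2
    have h3 : (1 / 2 : ℝ) ≤ ∑ i, c i * ‖X i‖ ^ 2 * (A i).indicator 1 g := by
      by_contra! hlt
      nlinarith
    rw [hfg, show (2⁻¹ : ENNReal) = ENNReal.ofReal (1 / 2) by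
      rw [one_div, ENNReal.ofReal_inv_of_pos two_pos]; simp]
    exact ENNReal.ofReal_le_ofReal h3
  calc stdGaussian E {g | ∑ i, c i * inner ℝ (X i) g ^ 2 ≤ t}
      ≤ stdGaussian E {g | 2⁻¹ ≤ f g} := measure_mono hsub
    _ ≤ (∫⁻ g, f g ∂stdGaussian E) / 2⁻¹ :=
        meas_ge_le_lintegral_div hfm.aemeasurable (by simp) (by simp)
    _ ≤ q / 2⁻¹ := ENNReal.div_le_div_right hint _
    _ = 2 * q := by rw [div_eq_mul_inv, inv_inv, mul_comm]

end StdGaussian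

/-- The Gaussian has no atom at `0`; outer regularity gives a small interval around it. -/
theorem exists_gaussianReal_sq_le_lt {ε : ENNReal} (hε : 0 < ε) :
    ∃ t : ℝ, 0 < t ∧ gaussianReal 0 1 {z | z ^ 2 ≤ 2 * t} ≤ ε := by
  have := nullSingletonClass_gaussianReal (μ := 0) (v := 1) one_ne_zero
  obtain ⟨U, hU0, hUo, hU⟩ := Set.exists_isOpen_lt_of_lt ({0} : Set ℝ) (μ := gaussianReal 0 1) ε
    (by simpa using hε)
  obtain ⟨r, hr, hball⟩ := Metric.isOpen_iff.1 hUo 0 (hU0 rfl)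
  refine ⟨r ^ 2 / 4, by positivity, (measure_mono fun z hz => hball ?_).trans hU.le⟩
  rw [mem_ball_zero_iff, Real.norm_eq_abs]
  refine abs_lt_of_sq_lt_sq ?_ hr.le
  have : z ^ 2 ≤ 2 * (r ^ 2 / 4) := hz
  nlinarith

/-- Markov's inequality, in a form that includes a vanishing mean. -/
theorem measure_lt_le_of_integral_le {Ω : Type*} [MeasurableSpace Ω] {P : Measure Ω}
    [IsProbabilityMeasure P] {W : Ω → ℝ} (hW : ∀ ω, 0 ≤ W ω) (hint : Integrable W P) {B : ℝ}
    (hB : ∫ ω, W ω ∂P ≤ B) {ε : ℝ} (hε : 0 < ε) :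
    P {ω | B / ε < W ω} ≤ ENNReal.ofReal ε := by
  have hI : 0 ≤ ∫ ω, W ω ∂P := integral_nonneg hW
  -- If `B = 0`, then `W` vanishes almost surely and the strict event is null.
  rcases (hI.trans hB).eq_or_lt with h0 | h0
  · have : W =ᵐ[P] 0 := (integral_eq_zero_iff_of_nonneg hW hint).1 (le_antisymm (h0 ▸ hB) hI)
    have hz : P {ω | B / ε < W ω} = 0 := by
      refine measure_mono_null (fun ω hω => ?_) (ae_iff.1 this)
      rw [Set.mem_ofPred_eq, ← h0, zero_div] at hω
      exact hω.ne'
    simp [hz]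
  · have h := mul_meas_ge_le_integral_of_nonneg (Filter.Eventually.of_forall hW) hint (B / ε)
    have hr : P.real {ω | B / ε ≤ W ω} ≤ ε := by
      have := h.trans hB
      rw [div_mul_eq_mul_div, div_le_iff₀ hε] at this
      exact le_of_mul_le_mul_left this h0
    calc P {ω | B / ε < W ω} ≤ P {ω | B / ε ≤ W ω} :=
          measure_mono fun ω (hω : B / ε < W ω) => hω.le
      _ = ENNReal.ofReal (P.real {ω | B / ε ≤ W ω}) := (ofReal_measureReal).symm
      _ ≤ _ := ENNReal.ofReal_le_ofReal hr

/-! ### The energy of the rounded vector -/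

namespace SubmodularHypergraph

variable {V : Type*} [DecidableEq V] (G : SubmodularHypergraph V) {n : ℕ}

/-- The span of the columns of the vertices of a hyperedge. -/
def edgeSpan (X : V → EuclideanSpace ℝ (Fin n)) (e : Finset V) :
    Submodule ℝ (EuclideanSpace ℝ (Fin n)) :=
  Submodule.span ℝ (X '' e)

/-- An upper bound for the energy of `Xᵀ g` that is a quadratic form in `g`. -/
noncomputable def energyBound (X : V → EuclideanSpace ℝ (Fin n)) (η : G.E → ℝ)
    (g : EuclideanSpace ℝ (Fin n)) : ℝ :=
  ∑ e : G.E, G.ϑ e * η e ^ 2 * projNormSq (edgeSpan X e) g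

theorem energyBound_nonneg (X : V → EuclideanSpace ℝ (Fin n)) (η : G.E → ℝ)
    (g : EuclideanSpace ℝ (Fin n)) : 0 ≤ G.energyBound X η g :=
  Finset.sum_nonneg fun e _ => mul_nonneg (mul_nonneg (G.ϑ_nonneg e e.2) (sq_nonneg _))
    (projNormSq_nonneg _ _)

theorem integrable_energyBound (X : V → EuclideanSpace ℝ (Fin n)) (η : G.E → ℝ) :
    Integrable (G.energyBound X η) (stdGaussian (EuclideanSpace ℝ (Fin n))) :=
  integrable_finsetSum _ fun _ _ => (integrable_projNormSq _).const_mul _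

/-- The projection onto the span of an edge has mean squared norm equal to its dimension, at most
the number of vertices of the edge. -/
theorem integral_energyBound_le (X : V → EuclideanSpace ℝ (Fin n)) (η : G.E → ℝ) :
    ∫ g, G.energyBound X η g ∂stdGaussian (EuclideanSpace ℝ (Fin n)) ≤
      G.maxEdgeCard * G.sdpObjective η := by
  simp only [energyBound]
  rw [integral_finsetSum _ fun _ _ => (integrable_projNormSq _).const_mul _, sdpObjective,
    Finset.mul_sum]
  refine Finset.sum_le_sum fun e _ => ?_
  rw [integral_const_mul, integral_projNormSq, mul_comm]
  refine mul_le_mul_of_nonneg_right ?_ (mul_nonneg (G.ϑ_nonneg e e.2) (sq_nonneg _))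
  have h1 : Module.finrank ℝ (edgeSpan X e) ≤ (e : Finset V).card := by
    classical
    rw [edgeSpan, ← Finset.coe_image]
    exact (finrank_span_finset_le_card _).trans Finset.card_image_le
  exact_mod_cast h1.trans (Finset.le_sup (f := Finset.card) e.2)

variable {G} [Fintype V]

theorem IsSDPFeasible.sum_gaussianRounding_sq_le {X : V → EuclideanSpace ℝ (Fin n)}
    {η : G.E → ℝ} (h : G.IsSDPFeasible X η) {y : Finset V → V → ℝ}
    (hy : ∀ e ∈ G.E, y e ∈ G.basePolytope e) (g : EuclideanSpace ℝ (Fin n)) :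
    ∑ e ∈ G.E, G.ϑ e * (∑ v, y e v * gaussianRounding X g v) ^ 2 ≤ G.energyBound X η g := by
  rw [energyBound, ← Finset.sum_coe_sort G.E]
  refine Finset.sum_le_sum fun e _ => ?_
  have hmem : ∑ v, y e v • X v ∈ edgeSpan X e := by
    refine Submodule.sum_mem _ fun v _ => ?_
    by_cases hv : v ∈ (e : Finset V)
    · exact Submodule.smul_mem _ _ (Submodule.subset_span ⟨v, hv, rfl⟩)
    · rw [G.eq_zero_of_mem_basePolytope e.2 (hy e e.2) hv, zero_smul]
      exact Submodule.zero_mem _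
  have hin : ∑ v, y e v * gaussianRounding X g v = inner ℝ (∑ v, y e v • X v) g := by
    simp [gaussianRounding, sum_inner, real_inner_smul_left]
  rw [hin, mul_assoc]
  refine mul_le_mul_of_nonneg_left ?_ (G.ϑ_nonneg e e.2)
  exact (inner_sq_le_norm_sq_mul_projNormSq hmem g).trans
    (mul_le_mul_of_nonneg_right (h.norm_sq_le e (hy e e.2)) (projNormSq_nonneg _ _))

theorem IsSDPFeasible.mean_gaussianRounding {X : V → EuclideanSpace ℝ (Fin n)}
    {η : G.E → ℝ} (h : G.IsSDPFeasible X η) (g : EuclideanSpace ℝ (Fin n)) :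
    ∑ v, G.μ v * gaussianRounding X g v = 0 := by
  have : ∑ v, G.μ v * gaussianRounding X g v = inner ℝ (∑ v, G.μ v • X v) g := by
    simp [gaussianRounding, sum_inner, real_inner_smul_left]
  rw [this, h.mean, inner_zero_left]

variable (G)

theorem exists_ne_of_mean_zero {x : V → ℝ} (hx : ∑ v, G.μ v * x v = 0)
    (hpos : 0 < ∑ v, G.μ v * x v ^ 2) : ∃ u v, x u ≠ x v := by
  by_contra! hcon
  have h0 : ∀ u, x u = 0 := fun u => by
    have h : (∑ v, G.μ v) * x u = 0 := by
      rw [Finset.sum_mul, ← hx]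
      exact Finset.sum_congr rfl fun v _ => by rw [hcon u v]
    exact (mul_eq_zero.1 h).resolve_left (G.vol_pos (S := Finset.univ) ⟨u, by simp⟩).ne'
  simp [h0] at hpos

end SubmodularHypergraph

/-- The algorithm solves the SDP relaxation in dimension `n ≥ ζ(E)`, draws `g ∼ N(0, I_n)` and
outputs `x = Xᵀ g`. For every `δ > 0` there is a constant `C`, depending on `δ` only, such that, for
every submodular hypergraph and every optimal solution of the SDP, the event that `x` is nonconstant
and `c(x) ≤ C √(ζ(E) τ h₂)` has probability at least `1 - δ` (its complement has measure at most
`δ`). -/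
theorem theorem6 (δ : ℝ) (hδ : 0 < δ) :
    ∃ C : ℝ, 0 < C ∧
      ∀ (N n : ℕ) (G : SubmodularHypergraph (Fin N)), G.maxEdgeCard ≤ n →
        ∀ (X : Fin N → EuclideanSpace ℝ (Fin n)) (η : G.E → ℝ), G.IsSDPSolution X η →
          stdGaussian (EuclideanSpace ℝ (Fin n))
            {g | ¬ ((∃ u v, gaussianRounding X g u ≠ gaussianRounding X g v) ∧
              G.thresholdConductance (gaussianRounding X g) ≤
                C * √(G.maxEdgeCard * G.tau * G.cheegerConst 2))} ≤ ENNReal.ofReal δ := by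

  obtain ⟨t, ht, htδ⟩ := exists_gaussianReal_sq_le_lt
    (ε := ENNReal.ofReal (δ / 4)) (ENNReal.ofReal_pos.2 (by positivity))
  -- `16 / (δ * t)` collects the sweep factor `4`, the SDP factor `2`, Markov at level `δ / 2`, and
  -- the lower bound `t`.
  refine ⟨√(16 / (δ * t)), Real.sqrt_pos.2 (by positivity), ?_⟩
  intro N n G _ X η hX
  set B : ℝ := G.maxEdgeCard * (2 * G.cheegerConst 2) with hB
  have hint := (G.integral_energyBound_le X η).trans
    (mul_le_mul_of_nonneg_left hX.sdpObjective_le_cheegerConst (Nat.cast_nonneg _))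
  have hlarge := measure_lt_le_of_integral_le (G.energyBound_nonneg X η)
    (G.integrable_energyBound X η) hint (half_pos hδ)
  have hsmall : stdGaussian (EuclideanSpace ℝ (Fin n))
      {g | ∑ v, G.μ v * inner ℝ (X v) g ^ 2 ≤ t} ≤ ENNReal.ofReal (δ / 2) := by
    refine (stdGaussian_sum_inner_sq_le (fun v => (G.μ_pos v).le) hX.feasible.norm ht).trans ?_
    refine (mul_le_mul_right htδ 2).trans (le_of_eq ?_)
    rw [← ENNReal.ofReal_ofNat 2, ← ENNReal.ofReal_mul (by norm_num)]
    congr 1; ring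
  refine (measure_mono (t := {g | B / (δ / 2) < G.energyBound X η g} ∪
    {g | ∑ v, G.μ v * inner ℝ (X v) g ^ 2 ≤ t}) ?_).trans ((measure_union_le _ _).trans
      ((add_le_add hlarge hsmall).trans (le_of_eq ?_)))
  · intro g hg
    by_contra hcon
    simp only [Set.mem_union, Set.mem_ofPred_eq, not_or, not_lt, not_le] at hcon
    obtain ⟨hQ, hY⟩ := hcon
    refine hg ?_
    have hmean := hX.feasible.mean_gaussianRounding g
    change t < ∑ v, G.μ v * gaussianRounding X g v ^ 2 at hY
    refine ⟨G.exists_ne_of_mean_zero hmean (ht.trans hY), ?_⟩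
    obtain ⟨y, hy, hc⟩ := G.sq_thresholdConductance_mul_le hmean
    set c := G.thresholdConductance (gaussianRounding X g)
    have h1 := hc.trans (mul_le_mul_of_nonneg_left
      ((hX.feasible.sum_gaussianRounding_sq_le hy g).trans hQ)
      (mul_nonneg (by norm_num) G.tau_nonneg))
    have h2 : c ^ 2 * t ≤ 4 * G.tau * (B / (δ / 2)) :=
      (mul_le_mul_of_nonneg_left hY.le (sq_nonneg c)).trans h1
    rw [← Real.sqrt_mul (by positivity)]
    refine Real.le_sqrt_of_sq_le ?_
    rw [← le_div_iff₀ ht] at h2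
    refine h2.trans (le_of_eq ?_)
    rw [hB]; field_simp; ring
  · rw [← ENNReal.ofReal_add (by positivity) (by positivity), add_halves]
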